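/- Let $(X,\mu)$ be a finite measure space and let $\varphi \in \mathrm{L}^\infty(X \times X)$. For $f \in \mathrm{L}^2(X\times X)$ let $K_f$ be the Hilbert--Schmidt operator on $\mathrm{L}^2(X)$ given by $(K_f\xi)(x)=\int_X f(x,y)\xi(y)\,\mathrm{d}\mu(y)$. We say that $\varphi$ induces a measurable Schur multiplier if the map $K_f \mapsto K_{\varphi f}$ on Hilbert--Schmidt operators is bounded for the operator norm; its unique weak* continuous linear extension $M_\varphi \colon \mathrm{B}(\mathrm{L}^2(X)) \to \mathrm{B}(\mathrm{L}^2(X))$ is then called the measurable Schur multiplier with symbol $\varphi$. A measurable function $\varphi \colon X\times X \to \mathbb{C}$ is called an integrally positive definite kernel if for every $\xi \in \mathrm{L}^1(X)$ the function $(x,y)\mapsto \varphi(x,y)\overline{\xi(x)}\xi(y)$ is integrable on $X\times X$ and $$\iint_{X\times X} \varphi(x,y)\overline{\xi(x)}\xi(y)\,\mathrm{d}\mu(x)\,\mathrm{d}\mu(y) \geq 0.$$ Consider the following properties: 1. $\varphi$ induces a completely positive measurable Schur multiplier $M_\varphi$; 2. $\varphi$ induces a positive measurable Schur multiplier $M_\varphi$;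 3. $\varphi$ (that is, each of its measurable representatives) is an integrally positive definite kernel. Then $1 \Leftrightarrow 2 \Rightarrow 3$. -/

import Mathlib

open MeasureTheory
open scoped ENNReal InnerProductSpace ComplexOrder

noncomputable section

namespace SchurMult

section HilbertSchmidt

variable {X : Type*} [MeasurableSpace X] {μ : Measure X} [SFinite μ]

theorem eLpNorm_two_sq {Y E : Type*} [MeasurableSpace Y] [NormedAddCommGroup E] {ν : Measure Y}
    (f : Y → E) : eLpNorm f 2 ν ^ (2 : ℝ) = ∫⁻ y, ‖f y‖ₑ ^ (2 : ℝ) ∂ν := by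
  have h := eLpNorm_nnreal_pow_eq_lintegral (μ := ν) (f := f) (p := 2) two_ne_zero
  simpa using h

theorem lintegral_section_sq (f : Lp ℂ 2 (μ.prod μ)) :
    ∫⁻ x, eLpNorm (fun y => f (x, y)) 2 μ ^ (2 : ℝ) ∂μ = eLpNorm f 2 (μ.prod μ) ^ (2 : ℝ) := by
  rw [eLpNorm_two_sq, lintegral_prod _
    ((Lp.aestronglyMeasurable f).enorm.pow_const _)]
  simp_rw [eLpNorm_two_sq]

theorem memLp_section (f : Lp ℂ 2 (μ.prod μ)) :
    ∀ᵐ x ∂μ, MemLp (fun y => f (x, y)) 2 μ := by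
  have hlt : ∫⁻ x, eLpNorm (fun y => f (x, y)) 2 μ ^ (2 : ℝ) ∂μ ≠ ∞ := by
    rw [lintegral_section_sq]
    exact (ENNReal.rpow_lt_top_of_nonneg (by norm_num) (Lp.eLpNorm_ne_top f)).ne
  have hm : AEMeasurable (fun x => eLpNorm (fun y => f (x, y)) 2 μ ^ (2 : ℝ)) μ := by
    simp_rw [eLpNorm_two_sq]
    exact ((Lp.aestronglyMeasurable f).enorm.pow_const _).lintegral_prod_right'
  filter_upwards [ae_lt_top' hm hlt, (Lp.aestronglyMeasurable f).prodMk_left] with x hx hxm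
  exact ⟨hxm, (ENNReal.rpow_lt_top_iff_of_pos (by norm_num)).1 hx⟩

/-- The function `x ↦ ∫ f(x,y) ξ(y) dy`. -/
def kernelFun (f : Lp ℂ 2 (μ.prod μ)) (ξ : Lp ℂ 2 μ) (x : X) : ℂ :=
  ∫ y, f (x, y) * ξ y ∂μ

theorem integrable_section_mul (f : Lp ℂ 2 (μ.prod μ)) :
    ∀ᵐ x ∂μ, ∀ ξ : Lp ℂ 2 μ, Integrable (fun y => f (x, y) * ξ y) μ := by
  filter_upwards [memLp_section f] with x hx ξ
  exact hx.integrable_mul (Lp.memLp ξ)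

theorem enorm_kernelFun_le (f : Lp ℂ 2 (μ.prod μ)) (ξ : Lp ℂ 2 μ) :
    ∀ᵐ x ∂μ, ‖kernelFun f ξ x‖ₑ ≤ eLpNorm (fun y => f (x, y)) 2 μ * eLpNorm ξ 2 μ := by
  filter_upwards [memLp_section f] with x hx
  refine (enorm_integral_le_lintegral_enorm _).trans ?_
  rw [← eLpNorm_one_eq_lintegral_enorm]
  have h := eLpNorm_smul_le_mul_eLpNorm (p := 2) (q := 2) (r := 1) (μ := μ)
    (Lp.aestronglyMeasurable ξ) hx.1
  simpa only [smul_eq_mul, Pi.mul_def] using h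

theorem eLpNorm_kernelFun_le (f : Lp ℂ 2 (μ.prod μ)) (ξ : Lp ℂ 2 μ) :
    eLpNorm (kernelFun f ξ) 2 μ ≤ eLpNorm f 2 (μ.prod μ) * eLpNorm ξ 2 μ := by
  rw [← ENNReal.rpow_le_rpow_iff (z := 2) (by norm_num), eLpNorm_two_sq,
    ENNReal.mul_rpow_of_nonneg _ _ (by norm_num), ← lintegral_section_sq,
    ← lintegral_mul_const' _ _
      (ENNReal.rpow_lt_top_of_nonneg (by norm_num) (Lp.eLpNorm_ne_top ξ)).ne]
  refine lintegral_mono_ae ?_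
  filter_upwards [enorm_kernelFun_le f ξ] with x hx
  rw [← ENNReal.mul_rpow_of_nonneg _ _ (by norm_num)]
  exact ENNReal.rpow_le_rpow hx (by norm_num)

theorem memLp_kernelFun (f : Lp ℂ 2 (μ.prod μ)) (ξ : Lp ℂ 2 μ) :
    MemLp (kernelFun f ξ) 2 μ := by
  refine ⟨?_, (eLpNorm_kernelFun_le f ξ).trans_lt
    (ENNReal.mul_lt_top (Lp.eLpNorm_lt_top f) (Lp.eLpNorm_lt_top ξ))⟩
  exact ((Lp.aestronglyMeasurable f).mul
    (Lp.aestronglyMeasurable ξ).comp_snd).integral_prod_right'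

/-- The Hilbert–Schmidt operator `K_f` on `L²(X)` with kernel `f ∈ L²(X × X)`:
`(K_f ξ)(x) = ∫ f(x,y) ξ(y) dy`. -/
def kernelOp (f : Lp ℂ 2 (μ.prod μ)) : Lp ℂ 2 μ →L[ℂ] Lp ℂ 2 μ :=
  LinearMap.mkContinuous
    { toFun := fun ξ => (memLp_kernelFun f ξ).toLp (kernelFun f ξ)
      map_add' := by
        intro ξ η
        rw [← MemLp.toLp_add]
        refine MemLp.toLp_congr _ _ ?_
        filter_upwards [integrable_section_mul f] with x hx
        simp only [kernelFun, Pi.add_apply]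
        rw [← integral_add (hx ξ) (hx η)]
        refine integral_congr_ae ?_
        filter_upwards [Lp.coeFn_add ξ η] with y hy
        rw [hy, Pi.add_apply, mul_add]
      map_smul' := by
        intro c ξ
        rw [RingHom.id_apply, ← MemLp.toLp_const_smul]
        refine MemLp.toLp_congr _ _ (Filter.Eventually.of_forall fun x => ?_)
        simp only [kernelFun, Pi.smul_apply, smul_eq_mul]
        rw [← integral_const_mul]
        refine integral_congr_ae ?_
        filter_upwards [Lp.coeFn_smul c ξ] with y hy
        rw [hy, Pi.smul_apply, smul_eq_mul]
        ring }
    ‖f‖ (by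
      intro ξ
      simp only [LinearMap.coe_mk, AddHom.coe_mk]
      rw [Lp.norm_toLp, Lp.norm_def, Lp.norm_def, ← ENNReal.toReal_mul]
      exact ENNReal.toReal_mono
        (ENNReal.mul_lt_top (Lp.eLpNorm_lt_top f) (Lp.eLpNorm_lt_top ξ)).ne
        (eLpNorm_kernelFun_le f ξ))

theorem kernelOp_apply_ae (f : Lp ℂ 2 (μ.prod μ)) (ξ : Lp ℂ 2 μ) :
    kernelOp f ξ =ᵐ[μ] fun x => ∫ y, f (x, y) * ξ y ∂μ :=
  MemLp.coeFn_toLp (memLp_kernelFun f ξ)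

end HilbertSchmidt

section WeakStar

variable (H : Type*) [NormedAddCommGroup H] [InnerProductSpace ℂ H]

/-- The weak* (that is, ultraweak, or `σ`-weak) topology of `B(H)`, given by the duality with the
trace class operators. Trace class operators are the sums `∑ₙ ⟪yₙ, ·⟫ xₙ` with `∑ ‖xₙ‖² < ∞` and
`∑ ‖yₙ‖² < ∞`, and the pairing of `T` with such an operator is `∑ₙ ⟪yₙ, T xₙ⟫`. -/
@[reducible] def weakStarTopology : TopologicalSpace (H →L[ℂ] H) :=
  ⨅ (x : ℕ → H) (y : ℕ → H) (_ : Summable fun n => ‖x n‖ ^ 2) (_ : Summable fun n => ‖y n‖ ^ 2),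
    TopologicalSpace.induced (fun T : H →L[ℂ] H => ∑' n, ⟪y n, T (x n)⟫_ℂ) inferInstance

variable {H}

/-- Positivity of a linear map on `B(H)` (for the Loewner order). -/
def IsPositiveMap (M : (H →L[ℂ] H) →L[ℂ] (H →L[ℂ] H)) : Prop :=
  ∀ T : H →L[ℂ] H, 0 ≤ T → 0 ≤ M T

/-- Complete positivity: all the entrywise amplifications `Mₖ(B(H)) → Mₖ(B(H))` are positive. -/
def IsCompletelyPositiveMap [CompleteSpace H] (M : (H →L[ℂ] H) →L[ℂ] (H →L[ℂ] H)) : Prop :=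
  ∃ Φ : CompletelyPositiveMap (H →L[ℂ] H) (H →L[ℂ] H), Φ.toLinearMap = M.toLinearMap

end WeakStar

variable {X : Type*} [MeasurableSpace X] {μ : Measure X} [SFinite μ]

/-- `φ ∈ L^∞(X × X)` induces a measurable Schur multiplier: the map `K_f ↦ K_{φf}` on the
Hilbert–Schmidt operators is bounded for the operator norm of `B(L²(X))`. -/
def InducesSchurMultiplier (φ : Lp ℂ ∞ (μ.prod μ)) : Prop :=
  ∃ C : ℝ, ∀ f : Lp ℂ 2 (μ.prod μ),
    ‖kernelOp (φ • f : Lp ℂ 2 (μ.prod μ))‖ ≤ C * ‖kernelOp f‖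

/-- `M` is the measurable Schur multiplier `M_φ` with symbol `φ`: the map `K_f ↦ K_{φf}` is
bounded, and `M` is its weak* continuous linear extension to `B(L²(X))`. -/
structure IsSchurMultiplier (φ : Lp ℂ ∞ (μ.prod μ))
    (M : (Lp ℂ 2 μ →L[ℂ] Lp ℂ 2 μ) →L[ℂ] (Lp ℂ 2 μ →L[ℂ] Lp ℂ 2 μ)) : Prop where
  induces : InducesSchurMultiplier φ
  extends_kernel : ∀ f : Lp ℂ 2 (μ.prod μ),
    M (kernelOp f) = kernelOp (φ • f : Lp ℂ 2 (μ.prod μ))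
  weakStar_continuous :
    @Continuous _ _ (weakStarTopology (Lp ℂ 2 μ)) (weakStarTopology (Lp ℂ 2 μ)) M

/-- `φ` induces a positive measurable Schur multiplier. -/
def InducesPositive (φ : Lp ℂ ∞ (μ.prod μ)) : Prop :=
  ∃ M, IsSchurMultiplier φ M ∧ IsPositiveMap M

/-- `φ` induces a completely positive measurable Schur multiplier. -/
def InducesCompletelyPositive (φ : Lp ℂ ∞ (μ.prod μ)) : Prop :=
  ∃ M, IsSchurMultiplier φ M ∧ IsCompletelyPositiveMap M

/-- Integrally positive definite kernels. The order on `ℂ` is the usual partial one, so the last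
condition says that the integral is a nonnegative real number. -/
def IsIntegrallyPositiveDefinite (μ : Measure X) (φ : X × X → ℂ) : Prop :=
  Measurable φ ∧ ∀ ξ : Lp ℂ 1 μ,
    Integrable (fun p : X × X => φ p * starRingEnd ℂ (ξ p.1) * ξ p.2) (μ.prod μ) ∧
    0 ≤ ∫ p : X × X, φ p * starRingEnd ℂ (ξ p.1) * ξ p.2 ∂(μ.prod μ)

end SchurMult

end

/-!
A measurable Schur multiplier is an `L^∞`-bimodule map: this is a direct computation on rank one
operators, whose span is weak* dense. Finitely many vectors `ξᵢ` of `L²` can always be written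
`ξᵢ = aᵢ e` with `aᵢ ∈ L^∞` and a single `e ∈ L²`, namely `e = ∑ |ξᵢ|`, so that
`∑ ⟪ξᵢ, M(Tᵢⱼ) ξⱼ⟫ = ⟪e, M(∑ aᵢ* Tᵢⱼ aⱼ) e⟫`. Hence positivity of `M` already gives positivity of
all its amplifications.

A function `ξ ∈ L¹` factors as `ū v` with `u, v ∈ L²`, and `⟪v, M(u ⊗ ū) v⟫` is the double integral
in the definition of an integrally positive definite kernel.
-/

namespace SchurMult

open Topology Filter InnerProductSpace ComplexConjugate

section OperatorMatrices

theorem star_mul_mul_apply {R n : Type*} [NonUnitalSemiring R] [StarRing R] [Fintype n]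
    (C T : CStarMatrix n n R) (i j : n) :
    (star C * T * C) i j = ∑ p, ∑ q, star (C p i) * T p q * C q j := by
  rw [mul_assoc]
  simp only [CStarMatrix.mul_apply, CStarMatrix.star_apply, Finset.mul_sum, mul_assoc]

variable {A : Type*} [NonUnitalCStarAlgebra A] [PartialOrder A] [StarOrderedRing A]
  {n : Type*} [Fintype n]

theorem nonneg_of_forall_conjugate_nonpos_imp_eq_zero {a : A} (ha : IsSelfAdjoint a)
    (h : ∀ b, star b * a * b ≤ 0 → star b * a * b = 0) : 0 ≤ a := by
  have hstar : star a⁻ = a⁻ := (CFC.negPart_nonneg a).isSelfAdjoint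
  have hconj : star a⁻ * a * a⁻ = -(star a⁻ * a⁻ * a⁻) := by
    nth_rewrite 2 [← CFC.posPart_sub_negPart a]
    rw [mul_sub, sub_mul, mul_assoc, CFC.posPart_mul_negPart, mul_zero, zero_sub]
  have hcube : star a⁻ * a⁻ * a⁻ = 0 := by
    refine neg_eq_zero.1 (hconj ▸ h a⁻ ?_)
    rw [hconj]
    exact neg_nonpos.2 (star_left_conjugate_nonneg (CFC.negPart_nonneg a) _)
  have hsq : a⁻ * a⁻ = 0 := by
    rw [← CStarRing.star_mul_self_eq_zero_iff, star_mul, mul_assoc, ← mul_assoc, mul_assoc,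
      ← mul_assoc (star a⁻) a⁻, hcube, mul_zero]
  rw [← CFC.negPart_eq_zero_iff a, ← CStarRing.star_mul_self_eq_zero_iff, hstar, hsq]

-- Instance search fails when the library lemma is applied to `CStarMatrix n n A` directly.
theorem exists_eq_star_mul_self {a : A} (ha : 0 ≤ a) : ∃ b, a = star b * b :=
  CStarAlgebra.nonneg_iff_eq_star_mul_self.1 ha

theorem diag_nonneg {T : CStarMatrix n n A} (hT : 0 ≤ T) (i : n) : 0 ≤ T i i := by
  obtain ⟨B, rfl⟩ := exists_eq_star_mul_self hT
  rw [CStarMatrix.mul_apply]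
  exact Finset.sum_nonneg fun p _ => star_mul_self_nonneg (B p i)

theorem eq_zero_of_nonneg_of_diag_eq_zero {T : CStarMatrix n n A} (hT : 0 ≤ T)
    (hdiag : ∀ i, T i i = 0) : T = 0 := by
  obtain ⟨B, rfl⟩ := exists_eq_star_mul_self hT
  have hB : B = 0 := by
    ext p i
    have hsum : ∑ p, star (B p i) * B p i = 0 := CStarMatrix.mul_apply.symm.trans (hdiag i)
    have hterm := (Finset.sum_eq_zero_iff_of_nonneg fun p _ => star_mul_self_nonneg (B p i)).1 hsum
    exact (CStarRing.star_mul_self_eq_zero_iff _).1 (hterm p (Finset.mem_univ p))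
  rw [hB, mul_zero]

theorem cstarMatrix_nonneg_iff {T : CStarMatrix n n A} (hT : IsSelfAdjoint T) :
    0 ≤ T ↔ ∀ b : n → A, 0 ≤ ∑ i, ∑ j, star (b i) * T i j * b j := by
  constructor
  · intro hpos b
    cases isEmpty_or_nonempty n with
    | inl _ => simp
    | inr hn =>
      obtain ⟨k⟩ := hn
      let C : CStarMatrix n n A := CStarMatrix.ofMatrix (Matrix.of fun i _ => b i)
      exact (diag_nonneg (star_left_conjugate_nonneg hpos C) k).trans_eq
        (star_mul_mul_apply C T k k)
  · refine fun h => nonneg_of_forall_conjugate_nonpos_imp_eq_zero hT fun C hC => ?_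
    refine neg_eq_zero.1 (eq_zero_of_nonneg_of_diag_eq_zero (neg_nonneg.2 hC) fun i => ?_)
    refine le_antisymm ?_ (diag_nonneg (neg_nonneg.2 hC) i)
    rw [CStarMatrix.neg_apply, neg_nonpos, star_mul_mul_apply]
    exact h fun p => C p i

end OperatorMatrices

section PositiveMaps

variable {H : Type*} [NormedAddCommGroup H] [InnerProductSpace ℂ H]

theorem nonneg_iff_forall_inner_nonneg {T : H →L[ℂ] H} : 0 ≤ T ↔ ∀ x, 0 ≤ ⟪x, T x⟫_ℂ := by
  rw [ContinuousLinearMap.nonneg_iff_isPositive]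
  refine ⟨fun hT => hT.inner_nonneg_right, fun hT => ?_⟩
  refine (ContinuousLinearMap.isPositive_iff_complex T).2 fun x => ?_
  obtain ⟨hre, him⟩ := RCLike.nonneg_iff.1 (hT x)
  rw [← inner_conj_symm, RCLike.conj_re, RCLike.conj_eq_iff_im.2 him]
  exact ⟨RCLike.conj_eq_iff_re.1 (RCLike.conj_eq_iff_im.2 him), hre⟩

variable [CompleteSpace H] {M : (H →L[ℂ] H) →L[ℂ] (H →L[ℂ] H)}

theorem IsPositiveMap.map_star (hM : IsPositiveMap M) (T : H →L[ℂ] H) :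
    M (star T) = star (M T) :=
  StarHomClass.map_star (PositiveLinearMap.mk₀ M.toLinearMap hM) T

theorem inner_sum_star_mul_mul {ι : Type*} [Fintype ι] (a : ι → H →L[ℂ] H)
    (T : ι → ι → H →L[ℂ] H) (x : H) :
    ⟪x, (∑ i, ∑ j, star (a i) * T i j * a j) x⟫_ℂ = ∑ i, ∑ j, ⟪a i x, T i j (a j x)⟫_ℂ := by
  simp only [sum_apply, mul_apply_eq_comp, inner_sum,
    ContinuousLinearMap.star_eq_adjoint, ContinuousLinearMap.adjoint_inner_right]

theorem IsPositiveMap.sum_inner_nonneg (hM : IsPositiveMap M) {S : Set (H →L[ℂ] H)}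
    (hmod : ∀ a ∈ S, ∀ b ∈ S, ∀ T, M (star a * T * b) = star a * M T * b)
    {ι : Type*} [Fintype ι] {T : CStarMatrix ι ι (H →L[ℂ] H)} (hT : 0 ≤ T)
    {a : ι → H →L[ℂ] H} (ha : ∀ i, a i ∈ S) (e : H) :
    0 ≤ ∑ i, ∑ j, ⟪a i e, M (T i j) (a j e)⟫_ℂ := by
  have hpos := hM _ ((cstarMatrix_nonneg_iff hT.isSelfAdjoint).1 hT a)
  simp only [map_sum, hmod _ (ha _) _ (ha _)] at hpos
  rw [← inner_sum_star_mul_mul a (fun i j => M (T i j))]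
  exact nonneg_iff_forall_inner_nonneg.1 hpos e

theorem IsPositiveMap.isCompletelyPositiveMap (hM : IsPositiveMap M) {S : Set (H →L[ℂ] H)}
    (hmod : ∀ a ∈ S, ∀ b ∈ S, ∀ T, M (star a * T * b) = star a * M T * b)
    (hS : ∀ (k : ℕ) (ξ : Fin k → H), ∃ e, ∃ a : Fin k → H →L[ℂ] H,
      (∀ i, a i ∈ S) ∧ ∀ i, a i e = ξ i) :
    IsCompletelyPositiveMap M := by
  refine ⟨⟨M.toLinearMap, fun k T hT => ?_⟩, rfl⟩
  have hsa : IsSelfAdjoint (T.map M.toLinearMap) := CStarMatrix.ext fun i j =>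
    (hM.map_star (T j i)).symm.trans
      (congrArg M (CStarMatrix.star_apply_of_isSelfAdjoint hT.isSelfAdjoint))
  refine (cstarMatrix_nonneg_iff hsa).2 fun b => ?_
  refine nonneg_iff_forall_inner_nonneg.2 fun x => ?_
  obtain ⟨e, a, haS, ha⟩ := hS k fun i => b i x
  have hsum := hM.sum_inner_nonneg hmod hT haS e
  simp only [ha] at hsum
  exact hsum.trans_eq (inner_sum_star_mul_mul b (fun i j => M (T i j)) x).symm

theorem IsCompletelyPositiveMap.isPositiveMap (hM : IsCompletelyPositiveMap M) :
    IsPositiveMap M := by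
  obtain ⟨Φ, hΦ⟩ := hM
  intro T hT
  exact (map_nonneg Φ hT).trans_eq (LinearMap.congr_fun hΦ T)

end PositiveMaps

section WeakStarTopology

variable {H : Type*} [NormedAddCommGroup H] [InnerProductSpace ℂ H]

theorem continuous_weakStar_inner (x y : H) :
    Continuous[weakStarTopology H, inferInstance] fun T : H →L[ℂ] H => ⟪y, T x⟫_ℂ := by
  have hsummable (z : H) : Summable fun n => ‖(Pi.single 0 z : ℕ → H) n‖ ^ 2 :=
    summable_of_ne_finset_zero (s := {0}) fun n hn => by
      simp [Pi.single_eq_of_ne (Finset.notMem_singleton.1 hn)]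
  have hpairing (T : H →L[ℂ] H) :
      ∑' n, ⟪(Pi.single 0 y : ℕ → H) n, T ((Pi.single 0 x : ℕ → H) n)⟫_ℂ = ⟪y, T x⟫_ℂ := by
    rw [tsum_eq_single 0 fun n hn => by simp [Pi.single_eq_of_ne hn]]
    simp only [Pi.single_eq_same]
  simp only [← hpairing]
  exact continuous_iInf_dom <| continuous_iInf_dom <| continuous_iInf_dom (i := hsummable x) <|
    continuous_iInf_dom (i := hsummable y) continuous_induced_dom

theorem t2Space_weakStarTopology : @T2Space (H →L[ℂ] H) (weakStarTopology H) := by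
  let _ : TopologicalSpace (H →L[ℂ] H) := weakStarTopology H
  refine T2Space.of_injective_continuous (f := fun (T : H →L[ℂ] H) (p : H × H) => ⟪p.2, T p.1⟫_ℂ)
    (fun S T h => ?_) (continuous_pi fun p => continuous_weakStar_inner p.1 p.2)
  ext x
  exact ext_inner_left ℂ fun y => congrFun h (x, y)

theorem tendsto_weakStar_of_tendsto_apply {ι : Type*} {l : Filter ι} {S : ι → H →L[ℂ] H}
    {T : H →L[ℂ] H} {C : ℝ} (hC : ∀ i, ‖S i‖ ≤ C)
    (hS : ∀ x, Tendsto (fun i => S i x) l (𝓝 (T x))) :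
    Tendsto S l (@nhds _ (weakStarTopology H) T) := by
  simp only [nhds_iInf, nhds_induced, tendsto_iInf, tendsto_comap_iff]
  intro x y hx hy
  refine tendsto_tsum_of_dominated_convergence (bound := fun n => C * (‖x n‖ ^ 2 + ‖y n‖ ^ 2))
    ((hx.add hy).mul_left C) (fun n => tendsto_const_nhds.inner (hS (x n)))
    (Eventually.of_forall fun i n => ?_)
  have hC0 : 0 ≤ C := (norm_nonneg _).trans (hC i)
  calc ‖⟪y n, S i (x n)⟫_ℂ‖ ≤ ‖y n‖ * ‖S i (x n)‖ := norm_inner_le_norm _ _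
    _ ≤ ‖y n‖ * (C * ‖x n‖) := by gcongr; exact (S i).le_of_opNorm_le (hC i) _
    _ = C * (‖x n‖ * ‖y n‖) := by ring
    _ ≤ C * (‖x n‖ ^ 2 + ‖y n‖ ^ 2) := by
      gcongr
      nlinarith [sq_nonneg (‖x n‖ - ‖y n‖), sq_nonneg (‖x n‖), sq_nonneg (‖y n‖)]

theorem tendsto_starProjection_span_finset (x : H) :
    Tendsto (fun F : Finset H => (Submodule.span ℂ (F : Set H)).starProjection x) atTop (𝓝 x) := by
  refine tendsto_const_nhds.congr' ?_
  filter_upwards [eventually_ge_atTop {x}] with F hF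
  exact (Submodule.starProjection_eq_self_iff.2 (Submodule.subset_span (by simpa using hF))).symm

theorem comp_starProjection_mem_span_rankOne (T : H →L[ℂ] H) (U : Submodule ℂ H)
    [FiniteDimensional ℂ U] :
    T ∘L U.starProjection ∈
      Submodule.span ℂ (Set.range fun p : H × H => rankOne ℂ p.1 p.2) := by
  let b := stdOrthonormalBasis ℂ U
  have hsum : T ∘L U.starProjection = ∑ i, rankOne ℂ (T (b i)) (b i : H) := by
    ext x
    simp [b.starProjection_eq_sum_rankOne]
  rw [hsum]
  exact Submodule.sum_mem _ fun i _ => Submodule.subset_span ⟨(T (b i), b i), rfl⟩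

theorem weakStar_dense_span_rankOne :
    @Dense (H →L[ℂ] H) (weakStarTopology H)
      (Submodule.span ℂ (Set.range fun p : H × H => rankOne ℂ p.1 p.2)) := by
  intro T
  let P (F : Finset H) : H →L[ℂ] H := (Submodule.span ℂ (F : Set H)).starProjection
  have hbound (F : Finset H) : ‖T ∘L P F‖ ≤ ‖T‖ * 1 := by
    grw [ContinuousLinearMap.opNorm_comp_le, Submodule.starProjection_norm_le]
  refine @mem_closure_of_tendsto _ (weakStarTopology H) _ _ _ _ atTop _
    (tendsto_weakStar_of_tendsto_apply hbound fun x => ?_)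
    (Eventually.of_forall fun F => comp_starProjection_mem_span_rankOne T _)
  exact (T.continuous.tendsto x).comp (tendsto_starProjection_span_finset x)

theorem linearMap_ext_of_rankOne {f g : (H →L[ℂ] H) →ₗ[ℂ] (H →L[ℂ] H)}
    (hf : Continuous[weakStarTopology H, weakStarTopology H] f)
    (hg : Continuous[weakStarTopology H, weakStarTopology H] g)
    (h : ∀ u v : H, f (rankOne ℂ u v) = g (rankOne ℂ u v)) : f = g :=
  DFunLike.coe_injective <|
    @Continuous.ext_on _ _ (weakStarTopology H) (weakStarTopology H) t2Space_weakStarTopology _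
      weakStar_dense_span_rankOne _ _ hf hg <|
        LinearMap.eqOn_span (Set.forall_mem_range.2 fun p : H × H => h p.1 p.2)

theorem summable_norm_sq_apply (A : H →L[ℂ] H) {x : ℕ → H} (hx : Summable fun n => ‖x n‖ ^ 2) :
    Summable fun n => ‖A (x n)‖ ^ 2 := by
  refine (hx.mul_left (‖A‖ ^ 2)).of_nonneg_of_le (fun n => sq_nonneg _) fun n => ?_
  rw [← mul_pow]
  gcongr
  exact A.le_opNorm (x n)

variable [CompleteSpace H]

theorem continuous_weakStar_mul_mul (A B : H →L[ℂ] H) :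
    Continuous[weakStarTopology H, weakStarTopology H] fun T : H →L[ℂ] H => A * T * B := by
  refine continuous_iInf_rng.2 fun x => continuous_iInf_rng.2 fun y =>
    continuous_iInf_rng.2 fun hx => continuous_iInf_rng.2 fun hy => continuous_induced_rng.2 ?_
  simp only [Function.comp_def, mul_apply_eq_comp, ← ContinuousLinearMap.adjoint_inner_left A]
  exact continuous_iInf_dom <| continuous_iInf_dom <|
    continuous_iInf_dom (i := summable_norm_sq_apply B hx) <|
      continuous_iInf_dom (i := summable_norm_sq_apply (ContinuousLinearMap.adjoint A) hy)
        continuous_induced_dom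

theorem map_mul_mul_of_rankOne {M : (H →L[ℂ] H) →ₗ[ℂ] (H →L[ℂ] H)}
    (hM : Continuous[weakStarTopology H, weakStarTopology H] M) (A B : H →L[ℂ] H)
    (h : ∀ u v : H, M (A * rankOne ℂ u v * B) = A * M (rankOne ℂ u v) * B) (T : H →L[ℂ] H) :
    M (A * T * B) = A * M T * B := by
  have hAB := continuous_weakStar_mul_mul A B
  exact LinearMap.congr_fun (linearMap_ext_of_rankOne
    (f := M ∘ₗ LinearMap.mulLeftRight ℂ (A, B)) (g := LinearMap.mulLeftRight ℂ (A, B) ∘ₗ M)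
    (@Continuous.comp _ _ _ (weakStarTopology H) (weakStarTopology H) (weakStarTopology H)
      (fun T => A * T * B) M hM hAB)
    (@Continuous.comp _ _ _ (weakStarTopology H) (weakStarTopology H) (weakStarTopology H)
      M (fun T => A * T * B) hAB hM) h) T

end WeakStarTopology

section MultiplicationOperators

variable {X 𝕜 : Type*} [MeasurableSpace X] [RCLike 𝕜] {μ : Measure X} {p : ℝ≥0∞}
  [Fact (1 ≤ p)]

/-- The operator on `L^p` of multiplication by an essentially bounded function. -/
noncomputable def mulOp (a : Lp 𝕜 ∞ μ) : Lp 𝕜 p μ →L[𝕜] Lp 𝕜 p μ :=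
  (ContinuousLinearMap.mul 𝕜 𝕜).holderL μ ∞ p p a

theorem coeFn_mulOp (a : Lp 𝕜 ∞ μ) (ξ : Lp 𝕜 p μ) : mulOp a ξ =ᵐ[μ] fun x => a x * ξ x :=
  (ContinuousLinearMap.mul 𝕜 𝕜).coeFn_holder a ξ

theorem adjoint_mulOp (a : Lp 𝕜 ∞ μ) :
    ContinuousLinearMap.adjoint (mulOp a : Lp 𝕜 2 μ →L[𝕜] Lp 𝕜 2 μ) = mulOp (star a) := by
  rw [eq_comm, ContinuousLinearMap.eq_adjoint_iff]
  intro ξ η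
  simp only [L2.inner_def]
  refine integral_congr_ae ?_
  filter_upwards [coeFn_mulOp a η, coeFn_mulOp (star a) ξ, Lp.coeFn_star a] with x hη hξ ha
  simp only [hη, hξ, ha, RCLike.inner_apply, Pi.star_apply, map_mul, RCLike.star_def,
    RCLike.conj_conj]
  ring

theorem exists_mulOp_apply_eq {ι : Type*} [Finite ι] (ξ : ι → Lp 𝕜 p μ) :
    ∃ (e : Lp 𝕜 p μ) (a : ι → Lp 𝕜 ∞ μ), ∀ i, mulOp (a i) e = ξ i := by
  cases nonempty_fintype ι
  let e (x : X) : 𝕜 := ((∑ i, ‖ξ i x‖ : ℝ) : 𝕜)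
  have he : MemLp e p μ := (memLp_finsetSum _ fun i _ => (Lp.memLp (ξ i)).norm).ofReal
  have hle (i : ι) (x : X) : ‖ξ i x‖ ≤ ‖e x‖ := by
    rw [RCLike.norm_of_nonneg (Finset.sum_nonneg fun _ _ => norm_nonneg _)]
    exact Finset.single_le_sum (f := fun i => ‖ξ i x‖) (fun _ _ => norm_nonneg _)
      (Finset.mem_univ i)
  have ha (i : ι) : MemLp (fun x => ξ i x / e x) ∞ μ := by
    refine memLp_top_of_bound
      ((Lp.aestronglyMeasurable (ξ i)).aemeasurable.div he.1.aemeasurable).aestronglyMeasurable 1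
      (Eventually.of_forall fun x => ?_)
    rw [norm_div]
    exact div_le_one_of_le₀ (hle i x) (norm_nonneg _)
  refine ⟨he.toLp e, fun i => (ha i).toLp _, fun i => Lp.ext ?_⟩
  filter_upwards [coeFn_mulOp ((ha i).toLp _) (he.toLp e), he.coeFn_toLp, (ha i).coeFn_toLp]
    with x hmul hex hax
  rw [hmul, hex, hax]
  exact div_mul_cancel_of_imp fun h0 =>
    norm_le_zero_iff.1 ((hle i x).trans_eq (by rw [h0, norm_zero]))

theorem exists_ae_eq_conj_mul (ξ : Lp 𝕜 1 μ) :
    ∃ u v : Lp 𝕜 2 μ, ξ =ᵐ[μ] fun x => conj (u x) * v x := by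
  let r (x : X) : 𝕜 := (√‖ξ x‖ : ℝ)
  have hξ : Integrable ξ μ := memLp_one_iff_integrable.1 (Lp.memLp ξ)
  have hr : AEMeasurable r μ :=
    RCLike.continuous_ofReal.measurable.comp_aemeasurable
      hξ.aestronglyMeasurable.norm.aemeasurable.sqrt
  have hr_norm (x : X) : ‖r x‖ = √‖ξ x‖ := RCLike.norm_of_nonneg (Real.sqrt_nonneg _)
  have memLp_two {w : X → 𝕜} (hw : AEMeasurable w μ) (hnorm : ∀ x, ‖w x‖ = √‖ξ x‖) :
      MemLp w 2 μ := by
    rw [memLp_two_iff_integrable_sq_norm hw.aestronglyMeasurable]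
    simpa only [hnorm, Real.sq_sqrt (norm_nonneg _)] using hξ.norm
  have hu := memLp_two hr hr_norm
  have hv := memLp_two (hξ.aestronglyMeasurable.aemeasurable.div hr) fun x => by
    rw [Pi.div_apply, norm_div, hr_norm, Real.div_sqrt]
  refine ⟨hu.toLp _, hv.toLp _, ?_⟩
  filter_upwards [hu.coeFn_toLp, hv.coeFn_toLp] with x hux hvx
  rw [hux, hvx, Pi.div_apply, RCLike.conj_ofReal]
  exact (mul_div_cancel_of_imp' fun h0 => by simpa [r] using h0).symm

end MultiplicationOperators

section Kernels

variable {X Y 𝕜 : Type*} [MeasurableSpace X] [MeasurableSpace Y] [RCLike 𝕜]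
  {μ : Measure X} {ν : Measure Y}

theorem memLp_mul_conj (u : Lp 𝕜 2 μ) (v : Lp 𝕜 2 ν) :
    MemLp (fun p : X × Y => u p.1 * conj (v p.2)) 2 (μ.prod ν) := by
  have hmeas : AEStronglyMeasurable (fun p : X × Y => u p.1 * conj (v p.2)) (μ.prod ν) :=
    (Lp.aestronglyMeasurable u).comp_fst.mul
      (RCLike.continuous_conj.comp_aestronglyMeasurable (Lp.aestronglyMeasurable v).comp_snd)
  rw [memLp_two_iff_integrable_sq_norm hmeas]
  simpa only [norm_mul, RCLike.norm_conj, mul_pow] using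
    (Lp.memLp u).norm.integrable_sq.mul_prod (Lp.memLp v).norm.integrable_sq

/-- The kernel `u ⊗ v̄`, that is, `(x, y) ↦ u(x) * conj (v(y))`, of the rank one operator
`ξ ↦ ⟪v, ξ⟫ u`. -/
noncomputable def tensorConj (u : Lp 𝕜 2 μ) (v : Lp 𝕜 2 ν) : Lp 𝕜 2 (μ.prod ν) :=
  (memLp_mul_conj u v).toLp _

theorem coeFn_tensorConj (u : Lp 𝕜 2 μ) (v : Lp 𝕜 2 ν) :
    tensorConj u v =ᵐ[μ.prod ν] fun p => u p.1 * conj (v p.2) :=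
  (memLp_mul_conj u v).coeFn_toLp

theorem integrable_mul_conj_mul (φ : Lp 𝕜 ∞ (μ.prod ν)) (ξ : Lp 𝕜 1 μ) (η : Lp 𝕜 1 ν) :
    Integrable (fun p : X × Y => φ p * conj (ξ p.1) * η p.2) (μ.prod ν) := by
  have hξ : Integrable (fun x => conj (ξ x)) μ := memLp_one_iff_integrable.1 (Lp.memLp ξ).star
  have hη : Integrable η ν := memLp_one_iff_integrable.1 (Lp.memLp η)
  simpa only [Pi.mul_def, mul_assoc] using (hξ.mul_prod hη).mul_of_top_right (Lp.memLp φ)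

variable {μ : Measure X} [SFinite μ]

theorem kernelOp_tensorConj (u v : Lp ℂ 2 μ) : kernelOp (tensorConj u v) = rankOne ℂ u v := by
  refine ContinuousLinearMap.ext fun ξ => Lp.ext ?_
  rw [rankOne_apply]
  filter_upwards [kernelOp_apply_ae (tensorConj u v) ξ,
    Measure.ae_ae_of_ae_prod (coeFn_tensorConj u v), Lp.coeFn_smul ⟪v, ξ⟫_ℂ u]
    with x hkernel htensor hsmul
  rw [hkernel, hsmul, Pi.smul_apply, smul_eq_mul, L2.inner_def, mul_comm, ← integral_const_mul]
  refine integral_congr_ae ?_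
  filter_upwards [htensor] with y hy
  rw [hy, RCLike.inner_apply]
  ring

theorem inner_kernelOp (f : Lp ℂ 2 (μ.prod μ)) (ξ η : Lp ℂ 2 μ) :
    ⟪ξ, kernelOp f η⟫_ℂ = ∫ p : X × X, f p * conj (ξ p.1) * η p.2 ∂(μ.prod μ) := by
  have hint : Integrable (fun p : X × X => f p * conj (ξ p.1) * η p.2) (μ.prod μ) := by
    refine ((Lp.memLp f).integrable_mul (memLp_mul_conj ξ η).star).congr
      (Eventually.of_forall fun p => ?_)
    simp [mul_assoc]
  rw [L2.inner_def, integral_prod _ hint]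
  refine integral_congr_ae ?_
  filter_upwards [kernelOp_apply_ae f η] with x hx
  rw [hx, RCLike.inner_apply, mul_comm, ← integral_const_mul]
  refine integral_congr_ae (Eventually.of_forall fun y => ?_)
  ring

end Kernels

section SchurMultipliers

variable {X : Type*} [MeasurableSpace X] {μ : Measure X} [SFinite μ] {φ : Lp ℂ ∞ (μ.prod μ)}
  {M : (Lp ℂ 2 μ →L[ℂ] Lp ℂ 2 μ) →L[ℂ] (Lp ℂ 2 μ →L[ℂ] Lp ℂ 2 μ)}

theorem IsSchurMultiplier.inner_map_rankOne (hM : IsSchurMultiplier φ M) (u v ξ η : Lp ℂ 2 μ) :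
    ⟪ξ, M (rankOne ℂ u v) η⟫_ℂ =
      ∫ p : X × X, φ p * (conj (ξ p.1) * u p.1) * (conj (v p.2) * η p.2) ∂(μ.prod μ) := by
  rw [← kernelOp_tensorConj, hM.extends_kernel, inner_kernelOp]
  refine integral_congr_ae ?_
  filter_upwards [Lp.coeFn_lpSMul (r := 2) φ (tensorConj u v), coeFn_tensorConj u v]
    with p hsmul htensor
  rw [hsmul, Pi.smul_apply', htensor, smul_eq_mul]
  ring

theorem IsSchurMultiplier.map_mulOp_mul_rankOne_mul_mulOp (hM : IsSchurMultiplier φ M)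
    (a b : Lp ℂ ∞ μ) (u v : Lp ℂ 2 μ) :
    M (mulOp a * rankOne ℂ u v * mulOp b) = mulOp a * M (rankOne ℂ u v) * mulOp b := by
  have hrankOne : mulOp a * rankOne ℂ u v * mulOp b =
      rankOne ℂ (mulOp a u) (mulOp (star b) v) := by
    rw [ContinuousLinearMap.mul_def, ContinuousLinearMap.mul_def, comp_rankOne,
      rankOne_comp, adjoint_mulOp]
  ext1 η
  refine ext_inner_left ℂ fun ξ => ?_
  rw [mul_apply_eq_comp, mul_apply_eq_comp,
    ← ContinuousLinearMap.adjoint_inner_left (mulOp a : Lp ℂ 2 μ →L[ℂ] Lp ℂ 2 μ), adjoint_mulOp,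
    hrankOne, hM.inner_map_rankOne, hM.inner_map_rankOne]
  refine integral_congr_ae ?_
  filter_upwards [Measure.quasiMeasurePreserving_fst.ae (coeFn_mulOp a u),
    Measure.quasiMeasurePreserving_fst.ae (coeFn_mulOp (star a) ξ),
    Measure.quasiMeasurePreserving_fst.ae (Lp.coeFn_star a),
    Measure.quasiMeasurePreserving_snd.ae (coeFn_mulOp b η),
    Measure.quasiMeasurePreserving_snd.ae (coeFn_mulOp (star b) v),
    Measure.quasiMeasurePreserving_snd.ae (Lp.coeFn_star b)] with p hu hξ ha hη hv hb
  simp only [hu, hξ, ha, hη, hv, hb, Pi.star_apply, map_mul, RCLike.star_def, RCLike.conj_conj]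
  ring

theorem IsSchurMultiplier.map_mulOp_mul_mul_mulOp (hM : IsSchurMultiplier φ M) (a b : Lp ℂ ∞ μ)
    (T : Lp ℂ 2 μ →L[ℂ] Lp ℂ 2 μ) : M (mulOp a * T * mulOp b) = mulOp a * M T * mulOp b :=
  map_mul_mul_of_rankOne (M := M.toLinearMap) hM.weakStar_continuous _ _
    (hM.map_mulOp_mul_rankOne_mul_mulOp a b) T

theorem IsSchurMultiplier.isCompletelyPositiveMap_iff (hM : IsSchurMultiplier φ M) :
    IsCompletelyPositiveMap M ↔ IsPositiveMap M := by
  refine ⟨IsCompletelyPositiveMap.isPositiveMap, fun hpos =>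
    hpos.isCompletelyPositiveMap (S := Set.range mulOp) ?_ fun k ξ => ?_⟩
  · rintro _ ⟨a, rfl⟩ _ ⟨b, rfl⟩ T
    rw [ContinuousLinearMap.star_eq_adjoint, adjoint_mulOp, hM.map_mulOp_mul_mul_mulOp]
  · obtain ⟨e, a, ha⟩ := exists_mulOp_apply_eq ξ
    exact ⟨e, fun i => mulOp (a i), fun i => ⟨a i, rfl⟩, ha⟩

theorem IsSchurMultiplier.integral_nonneg (hM : IsSchurMultiplier φ M) (hpos : IsPositiveMap M)
    (ξ : Lp ℂ 1 μ) : 0 ≤ ∫ p : X × X, φ p * conj (ξ p.1) * ξ p.2 ∂(μ.prod μ) := by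
  obtain ⟨u, v, hξ⟩ := exists_ae_eq_conj_mul ξ
  have hrankOne : 0 ≤ M (rankOne ℂ u u) :=
    hpos _ ((ContinuousLinearMap.nonneg_iff_isPositive _).2 (isPositive_rankOne_self u))
  have hinner : 0 ≤ ⟪v, M (rankOne ℂ u u) v⟫_ℂ := nonneg_iff_forall_inner_nonneg.1 hrankOne v
  rw [hM.inner_map_rankOne] at hinner
  refine hinner.trans_eq (integral_congr_ae ?_)
  filter_upwards [Measure.quasiMeasurePreserving_fst.ae hξ,
    Measure.quasiMeasurePreserving_snd.ae hξ] with p hfst hsnd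
  rw [hfst, hsnd, map_mul, Complex.conj_conj, mul_comm (u p.1)]

theorem InducesPositive.isIntegrallyPositiveDefinite (h : InducesPositive φ) {ψ : X × X → ℂ}
    (hψ : Measurable ψ) (hψφ : ψ =ᵐ[μ.prod μ] φ) : IsIntegrallyPositiveDefinite μ ψ := by
  obtain ⟨M, hM, hpos⟩ := h
  refine ⟨hψ, fun ξ => ?_⟩
  have hae : (fun p : X × X => φ p * conj (ξ p.1) * ξ p.2) =ᵐ[μ.prod μ]
      fun p => ψ p * conj (ξ p.1) * ξ p.2 := by
    filter_upwards [hψφ] with p hp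
    rw [hp]
  exact ⟨(integrable_mul_conj_mul φ ξ ξ).congr hae,
    (hM.integral_nonneg hpos ξ).trans_eq (integral_congr_ae hae)⟩

end SchurMultipliers

end SchurMult

theorem mainTheorem7_general {X : Type*} [MeasurableSpace X] (μ : Measure X) [SFinite μ]
    (φ : Lp ℂ ∞ (μ.prod μ)) :
    (SchurMult.InducesCompletelyPositive φ ↔ SchurMult.InducesPositive φ) ∧
    (SchurMult.InducesPositive φ →
      ∀ ψ : X × X → ℂ, Measurable ψ → ψ =ᵐ[μ.prod μ] φ →
        SchurMult.IsIntegrallyPositiveDefinite μ ψ) :=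
  ⟨exists_congr fun _ => and_congr_right fun hM => hM.isCompletelyPositiveMap_iff,
    fun h _ => h.isIntegrallyPositiveDefinite⟩

theorem mainTheorem7 {X : Type*} [MeasurableSpace X] (μ : Measure X) [IsFiniteMeasure μ]
    (φ : Lp ℂ ∞ (μ.prod μ)) :
    (SchurMult.InducesCompletelyPositive φ ↔ SchurMult.InducesPositive φ) ∧
    (SchurMult.InducesPositive φ →
      ∀ ψ : X × X → ℂ, Measurable ψ → ψ =ᵐ[μ.prod μ] φ →
        SchurMult.IsIntegrallyPositiveDefinite μ ψ) :=
  mainTheorem7_general μ φ
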